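/- Let $b_1,b_2,c_1,c_2,h_1,h_2$ be positive real numbers, and consider the normalized Leslie–Gower system with immigration $$ x_{n+1}=\frac{b_1x_n}{1+x_n+c_1y_n}+h_1,\qquad y_{n+1}=\frac{b_2y_n}{1+y_n+c_2x_n}+h_2,\qquad n=0,1,2,\ldots,\quad (x_0,y_0)\in[0,\infty)^2. \tag{LGIN} $$ An equilibrium of (LGIN) in $[0,\infty)^2$ is a point $(x,y)\in[0,\infty)^2$ that is fixed by the map $$T(x,y)=\left(\frac{b_1x}{1+x+c_1y}+h_1,\ \frac{b_2y}{1+y+c_2x}+h_2\right).$$ If at least one of the following conditions holds: (a) $1-b_1+h_1+c_1h_2\ge 0$ and $1-b_2+h_2+c_2h_1\ge 0$; (b) $c_1c_2\le 1$; then (LGIN) has exactly one equilibrium in $[0,\infty)^2$. -/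

import Mathlib

/-- The right-hand side of the normalized Leslie-Gower system with immigration
`x' = b₁ x / (1 + x + c₁ y) + h₁`, `y' = b₂ y / (1 + y + c₂ x) + h₂`.
For nonnegative `c₁, c₂` the denominators are positive on `[0,∞)²`. -/
noncomputable def LGINMap (b₁ b₂ c₁ c₂ h₁ h₂ : ℝ) (p : ℝ × ℝ) : ℝ × ℝ :=
  (b₁ * p.1 / (1 + p.1 + c₁ * p.2) + h₁, b₂ * p.2 / (1 + p.2 + c₂ * p.1) + h₂)

/-- An equilibrium of the system in `[0,∞)²`: a fixed point of its map lying there. -/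
def IsLGINEquilibrium (b₁ b₂ c₁ c₂ h₁ h₂ : ℝ) (p : ℝ × ℝ) : Prop :=
  p ∈ Set.Ici (0 : ℝ) ×ˢ Set.Ici (0 : ℝ) ∧
    Function.IsFixedPt (LGINMap b₁ b₂ c₁ c₂ h₁ h₂) p

/-!
In the coordinates `u = x - h₁`, `v = y - h₂` an equilibrium is a pair of positive roots of
`u (u + α + c v) = p` and `v (v + β + d u) = q`. For existence, solve each equation for its own
unknown; since `d ≥ 0`, the composition of the two solution maps sends `[0, r]` into itself, where
`r` is the positive root of `v (v + β) = q`.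

For uniqueness, subtract the equations satisfied by two solutions `(u, v)` and `(u', v')`:
`(p + u u') (u - u') = c u u' (v' - v)` and `(q + v v') (v - v') = d v v' (u' - u)`. If the two
solutions differ, this forces `(p + u u') (q + v v') = (c u u') (d v v')`. That is impossible when
`c d ≤ 1`. It is also impossible when `α, β ≥ 0`, since then `p + u u' > c u v` and
`q + v v' > d u' v'`, and the product of these lower bounds is again `(c u u') (d v v')`.
-/

section OrderedRing

variable {K : Type*} [CommRing K] [LinearOrder K]
variable {α α' β c d p q u u' v : K} {w w' : K × K}

/-- `u` is a positive root of the quadratic `u² + α u = p`. The linear coefficient `α` comes first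
because it is the argument that varies. -/
structure IsPosRoot (α p u : K) : Prop where
  pos : 0 < u
  mul_add_eq : u * (u + α) = p

/-- The two components of `w` are positive roots of quadratics, the linear coefficient of each
depending affinely on the other component. After the shift by the immigration rates, equilibria of
the Leslie-Gower system are of this form. -/
def IsCoupledPosRoot (α β c d p q : K) (w : K × K) : Prop :=
  IsPosRoot (α + c * w.2) p w.1 ∧ IsPosRoot (β + d * w.1) q w.2

theorem IsPosRoot.add_mul_mul_sub_eq (h : IsPosRoot α p u) (h' : IsPosRoot α' p u') :
    (p + u * u') * (u - u') = u * u' * (α' - α) := by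
  linear_combination u' * h.mul_add_eq - u * h'.mul_add_eq

theorem IsCoupledPosRoot.mul_mul_sub_eq (h : IsCoupledPosRoot α β c d p q w)
    (h' : IsCoupledPosRoot α β c d p q w') :
    (p + w.1 * w'.1) * (q + w.2 * w'.2) * (w.1 - w'.1) =
      c * (w.1 * w'.1) * (d * (w.2 * w'.2)) * (w.1 - w'.1) := by
  linear_combination (q + w.2 * w'.2) * h.1.add_mul_mul_sub_eq h'.1 -
    c * (w.1 * w'.1) * h.2.add_mul_mul_sub_eq h'.2

variable [IsStrictOrderedRing K]

theorem IsPosRoot.le_of_le (h : IsPosRoot α p u) (h' : IsPosRoot α' p u') (hp : 0 ≤ p)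
    (hα : α ≤ α') : u' ≤ u := by
  have hu := mul_pos h.pos h'.pos
  have hprod : 0 ≤ (p + u * u') * (u - u') := by
    rw [h.add_mul_mul_sub_eq h']
    exact mul_nonneg hu.le (sub_nonneg.mpr hα)
  exact sub_nonneg.mp (nonneg_of_mul_nonneg_right hprod (add_pos_of_nonneg_of_pos hp hu))

theorem IsPosRoot.unique (h : IsPosRoot α p u) (h' : IsPosRoot α p u') (hp : 0 ≤ p) : u = u' :=
  le_antisymm (h'.le_of_le h hp le_rfl) (h.le_of_le h' hp le_rfl)

theorem IsPosRoot.mul_mul_lt (h : IsPosRoot (α + c * v) p u) (hα : 0 ≤ α) (hu' : 0 < u') :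
    c * (u * v) < p + u * u' := by
  have hu := h.pos
  have hrest : 0 < u * (u + α + u') := by positivity
  linear_combination hrest + h.mul_add_eq

namespace IsCoupledPosRoot

theorem eq_of_mul_lt_mul (h : IsCoupledPosRoot α β c d p q w)
    (h' : IsCoupledPosRoot α β c d p q w') (hq : 0 ≤ q)
    (hlt : c * (w.1 * w'.1) * (d * (w.2 * w'.2)) < (p + w.1 * w'.1) * (q + w.2 * w'.2)) :
    w = w' := by
  have hfst : w.1 = w'.1 := by
    by_contra hne
    exact hlt.ne' (mul_right_cancel₀ (sub_ne_zero.mpr hne) (h.mul_mul_sub_eq h'))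
  have hsnd : IsPosRoot (β + d * w.1) q w'.2 := hfst ▸ h'.2
  exact Prod.ext hfst (h.2.unique hsnd hq)

theorem mul_lt_mul_of_nonneg (h : IsCoupledPosRoot α β c d p q w)
    (h' : IsCoupledPosRoot α β c d p q w') (hc : 0 ≤ c) (hd : 0 ≤ d) (hα : 0 ≤ α) (hβ : 0 ≤ β) :
    c * (w.1 * w'.1) * (d * (w.2 * w'.2)) < (p + w.1 * w'.1) * (q + w.2 * w'.2) := by
  have hu := h.1.pos
  have hv := h.2.pos
  have hu' := h'.1.pos
  have hv' := h'.2.pos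
  calc c * (w.1 * w'.1) * (d * (w.2 * w'.2))
      = c * (w.1 * w.2) * (d * (w'.2 * w'.1)) := by ring
    _ < (p + w.1 * w'.1) * (q + w'.2 * w.2) :=
      mul_lt_mul'' (h.1.mul_mul_lt hα hu') (h'.2.mul_mul_lt hβ hv) (by positivity) (by positivity)
    _ = (p + w.1 * w'.1) * (q + w.2 * w'.2) := by rw [mul_comm w'.2]

theorem mul_lt_mul_of_mul_le_one (h : IsCoupledPosRoot α β c d p q w)
    (h' : IsCoupledPosRoot α β c d p q w') (hp : 0 < p) (hq : 0 < q) (hcd : c * d ≤ 1) :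
    c * (w.1 * w'.1) * (d * (w.2 * w'.2)) < (p + w.1 * w'.1) * (q + w.2 * w'.2) := by
  have hu := mul_pos h.1.pos h'.1.pos
  have hv := mul_pos h.2.pos h'.2.pos
  calc c * (w.1 * w'.1) * (d * (w.2 * w'.2))
      = c * d * (w.1 * w'.1 * (w.2 * w'.2)) := by ring
    _ ≤ w.1 * w'.1 * (w.2 * w'.2) := mul_le_of_le_one_left (mul_pos hu hv).le hcd
    _ < (p + w.1 * w'.1) * (q + w.2 * w'.2) :=
      mul_lt_mul'' (lt_add_of_pos_left _ hp) (lt_add_of_pos_left _ hq) hu.le hv.le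

theorem unique (h : IsCoupledPosRoot α β c d p q w) (h' : IsCoupledPosRoot α β c d p q w')
    (hc : 0 ≤ c) (hd : 0 ≤ d) (hp : 0 < p) (hq : 0 < q)
    (H : (0 ≤ α ∧ 0 ≤ β) ∨ c * d ≤ 1) : w = w' :=
  h.eq_of_mul_lt_mul h' hq.le <| H.elim
    (fun hαβ ↦ h.mul_lt_mul_of_nonneg h' hc hd hαβ.1 hαβ.2) (h.mul_lt_mul_of_mul_le_one h' hp hq)

end IsCoupledPosRoot

end OrderedRing

section Real

variable {p q d : ℝ}

/-- The larger root of `u² + α u = p`, which for `0 < p` is its only positive root. -/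
noncomputable def posRoot (α p : ℝ) : ℝ :=
  (√(α ^ 2 + 4 * p) - α) / 2

theorem isPosRoot_posRoot (α : ℝ) (hp : 0 < p) : IsPosRoot α p (posRoot α p) where
  pos := half_pos (sub_pos.mpr (Real.lt_sqrt_of_sq_lt (by linarith)))
  mul_add_eq := by
    have hsq : √(α ^ 2 + 4 * p) ^ 2 = α ^ 2 + 4 * p := Real.sq_sqrt (by positivity)
    unfold posRoot
    linear_combination hsq / 4

theorem continuous_posRoot (p : ℝ) : Continuous fun α ↦ posRoot α p := by
  unfold posRoot
  fun_prop

theorem antitone_posRoot (hp : 0 < p) : Antitone fun α ↦ posRoot α p :=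
  fun α α' hα ↦ (isPosRoot_posRoot α hp).le_of_le (isPosRoot_posRoot α' hp) hp.le hα

theorem exists_isCoupledPosRoot (α β c : ℝ) (hd : 0 ≤ d) (hp : 0 < p) (hq : 0 < q) :
    ∃ w, IsCoupledPosRoot α β c d p q w := by
  let f (v : ℝ) : ℝ := posRoot (α + c * v) p
  let g (u : ℝ) : ℝ := posRoot (β + d * u) q
  have hf (v : ℝ) : IsPosRoot (α + c * v) p (f v) := isPosRoot_posRoot _ hp
  have hg (u : ℝ) : IsPosRoot (β + d * u) q (g u) := isPosRoot_posRoot _ hq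
  have hcont : Continuous (g ∘ f) :=
    ((continuous_posRoot q).comp (by fun_prop)).comp ((continuous_posRoot p).comp (by fun_prop))
  have hle (v : ℝ) : g (f v) ≤ posRoot β q :=
    antitone_posRoot hq (le_add_of_nonneg_right (mul_nonneg hd (hf v).pos.le))
  obtain ⟨v, -, hv⟩ := exists_mem_Icc_isFixedPt hcont.continuousOn
    (isPosRoot_posRoot β hq).pos.le (hg (f 0)).pos.le (hle _)
  exact ⟨(f v, v), hf v, hv.eq.subst (motive := IsPosRoot (β + d * f v) q) (hg (f v))⟩

theorem existsUnique_isCoupledPosRoot {α β c : ℝ} (hc : 0 ≤ c) (hd : 0 ≤ d) (hp : 0 < p)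
    (hq : 0 < q) (H : (0 ≤ α ∧ 0 ≤ β) ∨ c * d ≤ 1) :
    ∃! w, IsCoupledPosRoot α β c d p q w :=
  existsUnique_of_exists_of_unique (exists_isCoupledPosRoot α β c hd hp hq)
    fun _ _ h h' ↦ h.unique h' hc hd hp hq H

end Real

theorem isPosRoot_sub_iff {K : Type*} [Field K] [LinearOrder K] [IsStrictOrderedRing K]
    {b h e x : K} (hb : 0 < b) (hh : 0 < h) (he : 0 ≤ e) :
    IsPosRoot (1 - b + h + e) (b * h) (x - h) ↔ 0 ≤ x ∧ b * x / (1 + x + e) + h = x := by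
  constructor
  · rintro ⟨hpos, hroot⟩
    have hx : 0 < x := hh.trans (sub_pos.mp hpos)
    have hden : 0 < 1 + x + e := by positivity
    refine ⟨hx.le, ?_⟩
    rw [← eq_sub_iff_add_eq, div_eq_iff hden.ne']
    linear_combination -hroot
  · rintro ⟨hx, hfix⟩
    have hden : 0 < 1 + x + e := by positivity
    have hgrowth : b * x / (1 + x + e) = x - h := eq_sub_of_add_eq hfix
    have hhx : h ≤ x := sub_nonneg.mp (hgrowth ▸ by positivity)
    have hx' : 0 < x := hh.trans_le hhx
    refine ⟨hgrowth ▸ by positivity, ?_⟩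
    rw [div_eq_iff hden.ne'] at hgrowth
    linear_combination -hgrowth

theorem isLGINEquilibrium_iff_isCoupledPosRoot {b₁ b₂ c₁ c₂ h₁ h₂ : ℝ} (hb₁ : 0 < b₁)
    (hb₂ : 0 < b₂) (hc₁ : 0 ≤ c₁) (hc₂ : 0 ≤ c₂) (hh₁ : 0 < h₁) (hh₂ : 0 < h₂) (z : ℝ × ℝ) :
    IsLGINEquilibrium b₁ b₂ c₁ c₂ h₁ h₂ z ↔
      IsCoupledPosRoot (1 - b₁ + h₁ + c₁ * h₂) (1 - b₂ + h₂ + c₂ * h₁) c₁ c₂ (b₁ * h₁) (b₂ * h₂)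
        (z - (h₁, h₂)) := by
  obtain ⟨x, y⟩ := z
  have hα : 1 - b₁ + h₁ + c₁ * h₂ + c₁ * (y - h₂) = 1 - b₁ + h₁ + c₁ * y := by ring
  have hβ : 1 - b₂ + h₂ + c₂ * h₁ + c₂ * (x - h₁) = 1 - b₂ + h₂ + c₂ * x := by ring
  simp only [IsLGINEquilibrium, IsCoupledPosRoot, Function.IsFixedPt, LGINMap, Set.mem_prod,
    Set.mem_Ici, Prod.mk.injEq, Prod.mk_sub_mk, hα, hβ]
  constructor
  · rintro ⟨⟨hx, hy⟩, hfix₁, hfix₂⟩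
    exact ⟨(isPosRoot_sub_iff hb₁ hh₁ (by positivity)).mpr ⟨hx, hfix₁⟩,
      (isPosRoot_sub_iff hb₂ hh₂ (by positivity)).mpr ⟨hy, hfix₂⟩⟩
  · rintro ⟨hu, hv⟩
    have hx : 0 ≤ x := (hh₁.trans (sub_pos.mp hu.pos)).le
    have hy : 0 ≤ y := (hh₂.trans (sub_pos.mp hv.pos)).le
    exact ⟨⟨hx, hy⟩, ((isPosRoot_sub_iff hb₁ hh₁ (by positivity)).mp hu).2,
      ((isPosRoot_sub_iff hb₂ hh₂ (by positivity)).mp hv).2⟩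

theorem theorem5 (b₁ b₂ c₁ c₂ h₁ h₂ : ℝ)
    (hb₁ : 0 < b₁) (hb₂ : 0 < b₂) (hc₁ : 0 < c₁) (hc₂ : 0 < c₂)
    (hh₁ : 0 < h₁) (hh₂ : 0 < h₂)
    (H : (0 ≤ 1 - b₁ + h₁ + c₁ * h₂ ∧ 0 ≤ 1 - b₂ + h₂ + c₂ * h₁) ∨ c₁ * c₂ ≤ 1) :
    ∃! p : ℝ × ℝ, IsLGINEquilibrium b₁ b₂ c₁ c₂ h₁ h₂ p := by
  simp only [isLGINEquilibrium_iff_isCoupledPosRoot hb₁ hb₂ hc₁.le hc₂.le hh₁ hh₂]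
  exact (Equiv.subRight (h₁, h₂)).bijective.existsUnique_iff.mp <|
    existsUnique_isCoupledPosRoot hc₁.le hc₂.le (mul_pos hb₁ hh₁) (mul_pos hb₂ hh₂) H
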